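/- Let $G$ be a locally compact (Hausdorff) group with left Haar measure $m$, and let $1<q<\infty$. For a complex Banach space $E$, $n\in\mathbb N$, $\lambda=(\lambda_1,\dots,\lambda_n)\in (E')^n$ and $x=(x_1,\dots,x_n)\in E^n$, put $$\mu_{1,n}(\lambda)=\sup\Big\{\sum_{i=1}^n|\langle \lambda_i,\Phi\rangle| : \Phi\in E'',\ \|\Phi\|\le 1\Big\},\qquad \|x\|_n^{(1,q)}=\sup\Big\{\Big(\sum_{i=1}^n|\langle x_i,\lambda_i\rangle|^q\Big)^{1/q} : \lambda\in(E')^n,\ \mu_{1,n}(\lambda)\le 1\Big\}.$$ The group $G$ acts on $L^1(G)=L^1(G,m)$ by $(s\cdot f)(t)=f(s^{-1}t)$, and on $L^1(G)''$ by taking second adjoints. Suppose that $G$ is $(1,q)$-amenable, that is, there is a mean $\Lambda\in L^1(G)''$ (meaning $\langle 1,\Lambda\rangle=\|\Lambda\|=1$, where $1\in L^1(G)'$ is the functional $f\mapsto\int_G f\,dm$) such that $$\sup\big\{\|(s_1\cdot\Lambda,\dots,s_n\cdot\Lambda)\|_n^{(1,q)} : n\in\mathbb N,\ s_1,\dots,s_n\in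 G\big\}<\infty,$$ the norms being those for $E=L^1(G)''$. Then: (i) there is a constant $C\ge 1$ such that for every $n\in\mathbb N$ and every $n$-element set $F\subset G$ there is a compact set $S\subset G$ with $m(S)\neq 0$ and $$\frac{m(FS)}{m(S)}\le C\,n^{1-1/q};$$ (ii) for each $\varepsilon>0$ there is $n_0\in\mathbb N$ such that for all $n\ge n_0$ and every $n$-element set $F\subset G$ there is a compact set $S\subset G$ with $m(S)\neq 0$ and $$\frac{m(FS)}{m(S)}\le\varepsilon n.$$ -/

import Mathlib

open MeasureTheory
open scoped Pointwise

noncomputable section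

namespace MultiNorm

variable {E : Type*} [NormedAddCommGroup E] [NormedSpace ℂ E]

/-- The weak `p`-summing norm `μ_{p,n}(x)` of `x ∈ Eⁿ`: the supremum of
`(∑ᵢ |⟨xᵢ, φ⟩|ᵖ)^{1/p}` over all `φ` in the closed unit ball of the dual space `E'`. -/
def weakSummingNorm (p : ℝ) {n : ℕ} (x : Fin n → E) : ℝ :=
  sSup {r : ℝ | ∃ φ : StrongDual ℂ E, ‖φ‖ ≤ 1 ∧ r = (∑ i, ‖φ (x i)‖ ^ p) ^ (1 / p)}

/-- The weak `(p,q)`-multi-norm `‖x‖ₙ^{(p,q)}` of `x ∈ Eⁿ`: the supremum of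
`(∑ᵢ |⟨xᵢ, φᵢ⟩|^q)^{1/q}` over all `φ ∈ (E')ⁿ` with `μ_{p,n}(φ) ≤ 1`. -/
def weakMultiNorm (p q : ℝ) {n : ℕ} (x : Fin n → E) : ℝ :=
  sSup {r : ℝ | ∃ φ : Fin n → StrongDual ℂ E,
    weakSummingNorm p φ ≤ 1 ∧ r = (∑ i, ‖φ i (x i)‖ ^ q) ^ (1 / q)}

/-- A subset `B` of `E` is multi-bounded in the weak `(p,q)`-multi-norm if the norms
`‖(x₁,…,xₙ)‖ₙ^{(p,q)}`, for `n ∈ ℕ` and `x₁,…,xₙ ∈ B`, are bounded. -/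
def IsMultiBounded (p q : ℝ) (B : Set E) : Prop :=
  BddAbove {r : ℝ | ∃ (n : ℕ) (x : Fin n → E), (∀ i, x i ∈ B) ∧ r = weakMultiNorm p q x}

/-- The supremum in `weakSummingNorm` is over a bounded set. -/
lemma bddAbove_weakSummingNorm {p : ℝ} (hp : 1 ≤ p) {n : ℕ} (x : Fin n → E) :
    BddAbove {r : ℝ | ∃ φ : StrongDual ℂ E, ‖φ‖ ≤ 1 ∧
      r = (∑ i, ‖φ (x i)‖ ^ p) ^ (1 / p)} := by
  refine ⟨(∑ i, ‖x i‖ ^ p) ^ (1 / p), ?_⟩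
  rintro r ⟨φ, hφ, rfl⟩
  refine Real.rpow_le_rpow (by positivity) (Finset.sum_le_sum fun i _ => ?_) (by positivity)
  refine Real.rpow_le_rpow (by positivity) ?_ (by positivity)
  simpa using φ.le_of_opNorm_le hφ (x i)

/-- The coordinates of `x` are bounded in norm by its weak `p`-summing norm. -/
lemma norm_le_weakSummingNorm {p : ℝ} (hp : 1 ≤ p) {n : ℕ} (x : Fin n → E) (i : Fin n) :
    ‖x i‖ ≤ weakSummingNorm p x := by
  obtain ⟨φ, hφ, hx⟩ := exists_dual_vector'' ℂ (x i)
  have hp0 : 0 < p := by linarith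
  refine le_trans ?_ (le_csSup (bddAbove_weakSummingNorm hp x) ⟨φ, hφ, rfl⟩)
  have h1 : ‖x i‖ = (‖φ (x i)‖ ^ p) ^ (1 / p) := by
    rw [← Real.rpow_mul (norm_nonneg _), mul_one_div_cancel hp0.ne', Real.rpow_one, hx]
    simp
  rw [h1]
  refine Real.rpow_le_rpow (by positivity) ?_ (by positivity)
  exact Finset.single_le_sum (f := fun j => ‖φ (x j)‖ ^ p)
    (fun j _ => by positivity) (Finset.mem_univ i)

/-- The supremum in `weakMultiNorm` is over a bounded set. -/
lemma bddAbove_weakMultiNorm {p q : ℝ} (hp : 1 ≤ p) (hq : 1 ≤ q) {n : ℕ} (x : Fin n → E) :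
    BddAbove {r : ℝ | ∃ φ : Fin n → StrongDual ℂ E,
      weakSummingNorm p φ ≤ 1 ∧ r = (∑ i, ‖φ i (x i)‖ ^ q) ^ (1 / q)} := by
  refine ⟨(∑ i, ‖x i‖ ^ q) ^ (1 / q), ?_⟩
  rintro r ⟨φ, hφ, rfl⟩
  refine Real.rpow_le_rpow (by positivity) (Finset.sum_le_sum fun i _ => ?_) (by positivity)
  refine Real.rpow_le_rpow (by positivity) ?_ (by positivity)
  simpa using (φ i).le_of_opNorm_le ((norm_le_weakSummingNorm hp φ i).trans hφ) (x i)

end MultiNorm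

section Group

variable {G : Type*} [Group G] [TopologicalSpace G] [IsTopologicalGroup G]
  [MeasurableSpace G] [BorelSpace G]

/-- Left translation on `L¹(G)`: `(s · f)(t) = f(s⁻¹ t)`. -/
def leftTranslate (m : Measure G) [m.IsMulLeftInvariant] (s : G) :
    Lp ℂ 1 m →L[ℂ] Lp ℂ 1 m :=
  (Lp.compMeasurePreservingₗᵢ ℂ (fun t : G => s⁻¹ * t)
    (measurePreserving_mul_left m s⁻¹)).toContinuousLinearMap

/-- The action of `G` on `L¹(G)''` as second adjoint of left translation:
`⟨φ, s · Λ⟩ = ⟨φ ∘ (s · ), Λ⟩` for `φ ∈ L¹(G)'`. -/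
def bidualTranslate (m : Measure G) [m.IsMulLeftInvariant] (s : G)
    (Λ : StrongDual ℂ (StrongDual ℂ (Lp ℂ 1 m))) :
    StrongDual ℂ (StrongDual ℂ (Lp ℂ 1 m)) :=
  Λ.comp ((ContinuousLinearMap.compL ℂ (Lp ℂ 1 m) (Lp ℂ 1 m) ℂ).flip (leftTranslate m s))

/-- `Λ ∈ L¹(G)''` is a mean if `⟨1, Λ⟩ = ‖Λ‖ = 1`, where `1 ∈ L¹(G)'` is the functional
`f ↦ ∫ f dm`. -/
def IsMean (m : Measure G) (Λ : StrongDual ℂ (StrongDual ℂ (Lp ℂ 1 m))) : Prop :=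
  Λ (L1.integralCLM' ℂ) = 1 ∧ ‖Λ‖ = 1

/-- `G` (with left Haar measure `m`) is `(p,q)`-amenable, `1 ≤ p ≤ q < ∞`, if there is a mean
`Λ ∈ L¹(G)''` whose orbit `{s · Λ : s ∈ G}` is multi-bounded in the weak `(p,q)`-multi-norm
over `L¹(G)''`. -/
def IsPQAmenable (m : Measure G) [m.IsMulLeftInvariant] (p q : ℝ) : Prop :=
  ∃ Λ : StrongDual ℂ (StrongDual ℂ (Lp ℂ 1 m)),
    IsMean m Λ ∧ MultiNorm.IsMultiBounded p q (Set.range fun s : G => bidualTranslate m s Λ)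

end Group

end

/-!
Write `T f = (s₁ · f, …, sₙ · f)`, a map from `L¹(G)` to `L¹(G; ℂⁿ)` with the maximum norm on `ℂⁿ`.
A functional of norm one on `L¹(G; ℂⁿ)` is an `n`-tuple of functionals on `L¹(G)` with weak
`1`-summing norm at most one, so Hölder's inequality bounds `T'' Λ` in norm by
`n ^ (1 - 1 / q) * ‖(s₁ · Λ, …, sₙ · Λ)‖`. A mean `Λ` is a weak-star limit of probability densities,
hence by Hahn–Banach separation some density `f` has `‖T f‖` below any larger bound `a`. Now
`{t < ‖T f‖} = {s₁, …, sₙ} * {t < |f|}`, and integrating over `t` shows that some level set `A` of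
`|f|` satisfies `m (F * A) < a * m A`. Finally `A` is approximated from inside by a compact set.
-/

section PowerSums

variable {ι : Type*} {s : Finset ι}

lemma rpow_sum_norm_smul_rpow {q : ℝ} (hq : q ≠ 0) (c : ℂ) (z : ι → ℂ) :
    (∑ i ∈ s, ‖c • z i‖ ^ q) ^ (1 / q) = ‖c‖ * (∑ i ∈ s, ‖z i‖ ^ q) ^ (1 / q) := by
  simp only [norm_smul, Real.mul_rpow (norm_nonneg _) (norm_nonneg _), ← Finset.mul_sum]
  rw [Real.mul_rpow (by positivity) (by positivity), ← Real.rpow_mul (norm_nonneg _),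
    mul_one_div_cancel hq, Real.rpow_one]

lemma sum_norm_le_card_rpow_mul {q : ℝ} (hq : 1 ≤ q) (z : ι → ℂ) :
    ∑ i ∈ s, ‖z i‖ ≤ (s.card : ℝ) ^ (1 - 1 / q) * (∑ i ∈ s, ‖z i‖ ^ q) ^ (1 / q) := by
  simpa using Real.inner_le_weight_mul_Lp_of_nonneg s hq (fun _ => 1) (fun i => ‖z i‖)
    (fun _ => zero_le_one) fun _ => norm_nonneg _

lemma isLittleO_rpow_rpow_atTop_of_lt {a b : ℝ} (hab : a < b) :
    (fun x : ℝ => x ^ a) =o[Filter.atTop] fun x : ℝ => x ^ b := by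
  refine Asymptotics.isLittleO_of_tendsto' ?_ ?_
  · filter_upwards [Filter.eventually_gt_atTop 0] with x hx h
    exact absurd h (Real.rpow_pos_of_pos hx b).ne'
  · refine (tendsto_rpow_neg_atTop (sub_pos.2 hab)).congr' ?_
    filter_upwards [Filter.eventually_gt_atTop 0] with x hx
    rw [← Real.rpow_sub hx, neg_sub]

end PowerSums

namespace MultiNorm

variable {E : Type*} [NormedAddCommGroup E] [NormedSpace ℂ E] {n : ℕ}

lemma weakSummingNorm_nonneg (p : ℝ) (x : Fin n → E) : 0 ≤ weakSummingNorm p x := by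
  refine Real.sSup_nonneg ?_
  rintro r ⟨φ, -, rfl⟩
  positivity

lemma weakMultiNorm_nonneg (p q : ℝ) (x : Fin n → E) : 0 ≤ weakMultiNorm p q x := by
  refine Real.sSup_nonneg ?_
  rintro r ⟨φ, -, rfl⟩
  positivity

lemma weakSummingNorm_smul {p : ℝ} (hp : p ≠ 0) (c : ℂ) (x : Fin n → E) :
    weakSummingNorm p (c • x) = ‖c‖ * weakSummingNorm p x := by
  have hsmul : ∀ φ : StrongDual ℂ E, (∑ i, ‖φ ((c • x) i)‖ ^ p) ^ (1 / p) =
      ‖c‖ * (∑ i, ‖φ (x i)‖ ^ p) ^ (1 / p) := fun φ => by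
    simp only [Pi.smul_apply, map_smul]
    exact rpow_sum_norm_smul_rpow hp c _
  rw [weakSummingNorm, weakSummingNorm, ← smul_eq_mul, ← Real.sSup_smul_of_nonneg (norm_nonneg c)]
  congr 1
  ext r
  simp only [Set.mem_smul_set, Set.mem_ofPred_eq, hsmul, smul_eq_mul]
  constructor
  · rintro ⟨φ, hφ, rfl⟩
    exact ⟨_, ⟨φ, hφ, rfl⟩, rfl⟩
  · rintro ⟨_, ⟨φ, hφ, rfl⟩, rfl⟩
    exact ⟨φ, hφ, rfl⟩

lemma weakSummingNorm_inclusionInDoubleDual_le {p : ℝ} (hp : 1 ≤ p) (x : Fin n → E) :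
    weakSummingNorm p (fun i => NormedSpace.inclusionInDoubleDual ℂ E (x i)) ≤
      weakSummingNorm p x := by
  refine Real.sSup_le ?_ (weakSummingNorm_nonneg p x)
  rintro r ⟨φ, hφ, rfl⟩
  refine le_csSup (bddAbove_weakSummingNorm hp x)
    ⟨φ.comp (NormedSpace.inclusionInDoubleDual ℂ E), ?_, rfl⟩
  refine ContinuousLinearMap.opNorm_le_bound _ zero_le_one fun y => ?_
  exact φ.le_of_opNorm_le_of_le hφ (NormedSpace.double_dual_bound ℂ E y)

lemma weakSummingNorm_one_le_of_norm_sum_smul_le {C : ℝ} {x : Fin n → E}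
    (hx : ∀ c : Fin n → ℂ, (∀ i, ‖c i‖ = 1) → ‖∑ i, c i • x i‖ ≤ C) :
    weakSummingNorm 1 x ≤ C := by
  refine Real.sSup_le ?_ ((norm_nonneg _).trans (hx 1 fun _ => norm_one))
  rintro r ⟨φ, hφ, rfl⟩
  choose c hc hcφ using fun i => Complex.exists_norm_eq_mul_self (φ (x i))
  have hsum : ((∑ i, ‖φ (x i)‖ : ℝ) : ℂ) = φ (∑ i, c i • x i) := by
    simp only [Complex.ofReal_sum, hcφ, map_sum, map_smul, smul_eq_mul]
  calc (∑ i, ‖φ (x i)‖ ^ (1 : ℝ)) ^ (1 / 1 : ℝ) = ‖φ (∑ i, c i • x i)‖ := by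
        rw [← hsum, Complex.norm_real, Real.norm_of_nonneg (by positivity)]
        simp
    _ ≤ 1 * C := φ.le_of_opNorm_le_of_le hφ (hx c hc)
    _ = C := one_mul C

lemma rpow_sum_norm_apply_le {p q : ℝ} (hp : 1 ≤ p) (hq : 1 ≤ q) (x : Fin n → E)
    (φ : Fin n → StrongDual ℂ E) :
    (∑ i, ‖φ i (x i)‖ ^ q) ^ (1 / q) ≤ weakSummingNorm p φ * weakMultiNorm p q x := by
  have hp0 : p ≠ 0 := by positivity
  have hq0 : q ≠ 0 := by positivity
  rcases (weakSummingNorm_nonneg p φ).eq_or_lt with h0 | hpos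
  · have hφ : ∀ i, φ i = 0 := fun i =>
      norm_le_zero_iff.1 ((norm_le_weakSummingNorm hp φ i).trans_eq h0.symm)
    simp [hφ, ← h0, hq0]
  · set M := weakSummingNorm p φ
    have hnorm : ‖((M⁻¹ : ℝ) : ℂ)‖ = M⁻¹ := by
      rw [Complex.norm_real, Real.norm_of_nonneg (by positivity)]
    have hunit : weakSummingNorm p (((M⁻¹ : ℝ) : ℂ) • φ) ≤ 1 := by
      rw [weakSummingNorm_smul hp0, hnorm, inv_mul_cancel₀ hpos.ne']
    have hle := le_csSup (bddAbove_weakMultiNorm hp hq x) ⟨_, hunit, rfl⟩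
    simp only [Pi.smul_apply, smul_apply, rpow_sum_norm_smul_rpow hq0,
      hnorm] at hle
    exact (inv_mul_le_iff₀ hpos).1 hle

lemma sum_norm_apply_le {p q : ℝ} (hp : 1 ≤ p) (hq : 1 ≤ q) (x : Fin n → E)
    (φ : Fin n → StrongDual ℂ E) :
    ∑ i, ‖φ i (x i)‖ ≤
      (n : ℝ) ^ (1 - 1 / q) * (weakSummingNorm p φ * weakMultiNorm p q x) := by
  have hmean := sum_norm_le_card_rpow_mul (s := Finset.univ) hq fun i => φ i (x i)
  rw [Finset.card_fin] at hmean
  exact hmean.trans (mul_le_mul_of_nonneg_left (rpow_sum_norm_apply_le hp hq x φ) (by positivity))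

lemma sum_norm_dual_apply_le {p q : ℝ} (hp : 1 ≤ p) (hq : 1 ≤ q) (x : Fin n → StrongDual ℂ E)
    (y : Fin n → E) :
    ∑ i, ‖x i (y i)‖ ≤
      (n : ℝ) ^ (1 - 1 / q) * (weakSummingNorm p y * weakMultiNorm p q x) := by
  refine (sum_norm_apply_le hp hq x fun i => NormedSpace.inclusionInDoubleDual ℂ E (y i)).trans ?_
  exact mul_le_mul_of_nonneg_left (mul_le_mul_of_nonneg_right
    (weakSummingNorm_inclusionInDoubleDual_le hp y) (weakMultiNorm_nonneg p q x)) (by positivity)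

end MultiNorm

section UnitFace

variable {E F : Type*} [NormedAddCommGroup E] [NormedSpace ℂ E] [NormedAddCommGroup F]
  [NormedSpace ℂ F]

/-- The face of the closed unit ball on which the functional `e` takes the value `1`. For
`E = L¹(m)` and `e = ∫ · dm` these are the probability densities: nonnegativity is forced by
`‖f‖ ≤ 1 = ∫ f`. -/
def unitFace (e : StrongDual ℂ E) : Set E :=
  Metric.closedBall 0 1 ∩ e ⁻¹' {1}

lemma mem_unitFace {e : StrongDual ℂ E} {x : E} : x ∈ unitFace e ↔ ‖x‖ ≤ 1 ∧ e x = 1 := by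
  simp [unitFace]

lemma convex_unitFace (e : StrongDual ℂ E) : Convex ℝ (unitFace e) :=
  (convex_closedBall 0 1).inter
    ((convex_singleton 1).is_linear_preimage (e.toLinearMap.restrictScalars ℝ).isLinear)

/-- A functional `e` such that the norm of every functional is determined on `unitFace e`. -/
def IsNormingFace (e : StrongDual ℂ E) : Prop :=
  ∀ (η : StrongDual ℂ E) (c : ℝ), 0 ≤ c → (∀ x ∈ unitFace e, ‖η x‖ ≤ c) → ‖η‖ ≤ c

lemma exists_norm_sub_le_lt {a : ℝ} {w : ℂ} (hw : w.re < a) (B : ℝ) :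
    ∃ (R : ℂ) (ρ : ℝ), 0 ≤ ρ ∧ ρ < ‖R - w‖ ∧ ∀ z : ℂ, ‖z‖ ≤ B → a ≤ z.re → ‖R - z‖ ≤ ρ := by
  set R : ℝ := (a ^ 2 + B ^ 2 + 1) / (2 * (a - w.re))
  have hgap : 0 < 2 * (a - w.re) := mul_pos two_pos (sub_pos.2 hw)
  have hR0 : 0 ≤ R := div_nonneg (by positivity) hgap.le
  have hRgap : R * (2 * (a - w.re)) = a ^ 2 + B ^ 2 + 1 := div_mul_cancel₀ _ hgap.ne'
  have hsq : ∀ z : ℂ, ‖R - z‖ ^ 2 = R ^ 2 - 2 * R * z.re + ‖z‖ ^ 2 := fun z => by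
    simp only [Complex.sq_norm, Complex.normSq_apply, Complex.sub_re, Complex.sub_im,
      Complex.ofReal_re, Complex.ofReal_im]
    ring
  refine ⟨R, √((R - a) ^ 2 + B ^ 2), Real.sqrt_nonneg _, ?_, fun z hzB hza => ?_⟩
  · refine (Real.sqrt_lt_sqrt (by positivity) ?_).trans_eq (Real.sqrt_sq (norm_nonneg _))
    nlinarith [hsq w, sq_nonneg ‖w‖]
  · refine Real.le_sqrt_of_sq_le ?_
    have hz_sq : ‖z‖ ^ 2 ≤ B ^ 2 := pow_le_pow_left₀ (norm_nonneg z) hzB 2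
    nlinarith [hsq z, mul_le_mul_of_nonneg_left hza hR0, sq_nonneg a]

/-- The norm of `Λ` only controls distances, so the half-plane `a ≤ re z` is replaced by discs of
large radius. -/
lemma IsNormingFace.le_re_apply {e : StrongDual ℂ E} (he : IsNormingFace e)
    {Λ : StrongDual ℂ (StrongDual ℂ E)} (hΛ : ‖Λ‖ ≤ 1) (hΛe : Λ e = 1) {ψ : StrongDual ℂ E}
    {a : ℝ} (hψ : ∀ x ∈ unitFace e, a ≤ (ψ x).re) : a ≤ (Λ ψ).re := by
  by_contra! hlt
  obtain ⟨R, ρ, hρ, hfar, hnear⟩ := exists_norm_sub_le_lt hlt ‖ψ‖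
  have hnorm : ‖R • e - ψ‖ ≤ ρ := he _ ρ hρ fun x hx => by
    obtain ⟨hx1, hex⟩ := mem_unitFace.1 hx
    have hψx : ‖ψ x‖ ≤ ‖ψ‖ := ψ.unit_le_opNorm x hx1
    simpa [hex] using hnear (ψ x) hψx (hψ x hx)
  have hle : ‖R - Λ ψ‖ ≤ ρ := by
    simpa [hΛe] using Λ.le_of_opNorm_le_of_le hΛ hnorm
  exact hle.not_gt hfar

lemma mul_norm_le_of_re_le_on_ball {φ : StrongDual ℂ F} {r u : ℝ} (hr : 0 < r)
    (hφ : ∀ y ∈ Metric.ball (0 : F) r, (φ y).re ≤ u) : r * ‖φ‖ ≤ u := by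
  rw [← le_div_iff₀' hr, ← φ.sSup_unit_ball_eq_norm]
  refine csSup_le ((Metric.nonempty_ball.2 one_pos).image _) ?_
  rintro _ ⟨y, hy, rfl⟩
  obtain ⟨c, hc, hcy⟩ := Complex.exists_norm_eq_mul_self (φ y)
  have hmem : (r : ℂ) • c • y ∈ Metric.ball (0 : F) r := by
    rw [mem_ball_zero_iff, norm_smul, norm_smul, hc, one_mul, Complex.norm_real,
      Real.norm_of_nonneg hr.le]
    exact mul_lt_of_lt_one_right hr (mem_ball_zero_iff.1 hy)
  have hle := hφ _ hmem
  rw [map_smul, map_smul, smul_eq_mul, smul_eq_mul, ← hcy, ← Complex.ofReal_mul,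
    Complex.ofReal_re] at hle
  exact (le_div_iff₀' hr).2 hle

/-- By Hahn–Banach, a convex set `T '' unitFace e` missing a ball around `0` would be separated
from it by a functional `φ`, and `Λ (φ.comp T)` would be too large. -/
lemma IsNormingFace.exists_norm_apply_lt {e : StrongDual ℂ E} (he : IsNormingFace e)
    {Λ : StrongDual ℂ (StrongDual ℂ E)} (hΛ : ‖Λ‖ ≤ 1) (hΛe : Λ e = 1) (T : E →L[ℂ] F)
    {M a : ℝ} (hM : 0 ≤ M) (hMa : M < a) (hT : ∀ φ : StrongDual ℂ F, ‖Λ (φ.comp T)‖ ≤ M * ‖φ‖) :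
    ∃ x ∈ unitFace e, ‖T x‖ < a := by
  by_contra! hfar
  have ha : 0 < a := hM.trans_lt hMa
  have hconv : Convex ℝ (T '' unitFace e) :=
    (convex_unitFace e).is_linear_image (T.toLinearMap.restrictScalars ℝ).isLinear
  have hdisj : Disjoint (Metric.ball (0 : F) a) (T '' unitFace e) := by
    rw [Set.disjoint_left]
    rintro _ hy ⟨x, hx, rfl⟩
    exact (hfar x hx).not_gt (mem_ball_zero_iff.1 hy)
  obtain ⟨φ, u, hball, himage⟩ := RCLike.geometric_hahn_banach_open (𝕜 := ℂ)
    (convex_ball _ _) Metric.isOpen_ball hconv hdisj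
  have hu : 0 < u := by simpa using hball 0 (Metric.mem_ball_self ha)
  have hlower : a * ‖φ‖ ≤ u := mul_norm_le_of_re_le_on_ball ha fun y hy => (hball y hy).le
  have hupper : u ≤ M * ‖φ‖ :=
    calc u ≤ (Λ (φ.comp T)).re :=
          he.le_re_apply hΛ hΛe fun x hx => himage _ (Set.mem_image_of_mem T hx)
      _ ≤ ‖Λ (φ.comp T)‖ := Complex.re_le_norm _
      _ ≤ M * ‖φ‖ := hT φ
  have hφ : 0 < ‖φ‖ := pos_of_mul_pos_right (hu.trans_le hupper) hM
  exact hMa.not_ge (le_of_mul_le_mul_right (hlower.trans hupper) hφ)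

end UnitFace

section Densities

variable {α : Type*} [MeasurableSpace α] {μ : Measure α} {E : Type*} [NormedAddCommGroup E]

lemma smul_indicatorConstLp {𝕜 : Type*} [NormedField 𝕜] [NormedSpace 𝕜 E] {p : ENNReal}
    {A : Set α} (hA : MeasurableSet A) (hμA : μ A ≠ ⊤) (c : 𝕜) (x : E) :
    c • indicatorConstLp p hA hμA x = indicatorConstLp p hA hμA (c • x) := by
  rw [indicatorConstLp, indicatorConstLp, ← MemLp.toLp_const_smul]
  congr 1
  exact (Set.indicator_const_smul A c fun _ => x).symm

lemma norm_toLp_add_toLp_of_disjoint_support {f g : α → E} (hf : MemLp f 1 μ) (hg : MemLp g 1 μ)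
    (hfg : Disjoint (Function.support f) (Function.support g)) :
    ‖hf.toLp f + hg.toLp g‖ = ‖hf.toLp f‖ + ‖hg.toLp g‖ := by
  have hpointwise : ∀ x, ‖(f + g) x‖ₑ = ‖f x‖ₑ + ‖g x‖ₑ := fun x => by
    by_cases hx : f x = 0
    · simp [hx]
    · have hgx : g x = 0 := Function.notMem_support.1 (Set.disjoint_left.1 hfg hx)
      simp [hgx]
  rw [← MemLp.toLp_add, Lp.norm_toLp, Lp.norm_toLp, Lp.norm_toLp,
    ← ENNReal.toReal_add hf.eLpNorm_ne_top hg.eLpNorm_ne_top]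
  simp only [eLpNorm_one_eq_lintegral_enorm, hpointwise,
    lintegral_add_left' hf.aestronglyMeasurable.enorm]

lemma opNorm_le_of_norm_indicatorConstLp_le {𝕜 F : Type*} [NontriviallyNormedField 𝕜]
    [NormedSpace 𝕜 E] [NormedAddCommGroup F] [NormedSpace 𝕜 F] (T : Lp E 1 μ →L[𝕜] F) {C : ℝ}
    (hC : 0 ≤ C)
    (hT : ∀ (A : Set α) (hA : MeasurableSet A) (hμA : μ A ≠ ⊤) (x : E),
      ‖T (indicatorConstLp 1 hA hμA x)‖ ≤ C * ‖indicatorConstLp 1 hA hμA x‖) :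
    ‖T‖ ≤ C := by
  refine T.opNorm_le_bound hC (Lp.induction ENNReal.one_ne_top _ ?_ ?_ ?_)
  · exact fun x A hA hμA => hT A hA hμA.ne x
  · intro f g hf hg hfg hTf hTg
    rw [map_add, norm_toLp_add_toLp_of_disjoint_support hf hg hfg, mul_add]
    exact (norm_add_le _ _).trans (add_le_add hTf hTg)
  · exact isClosed_le (by fun_prop) (by fun_prop)

lemma integralCLM'_apply (f : Lp ℂ 1 μ) : L1.integralCLM' ℂ f = ∫ x, f x ∂μ := by
  rw [← L1.integral_eq', L1.integral_eq_integral]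

lemma one_le_norm_of_mem_unitFace_integral {f : Lp ℂ 1 μ}
    (hf : f ∈ unitFace (L1.integralCLM' ℂ)) : 1 ≤ ‖f‖ := by
  have hle := L1.norm_integral_le f
  rwa [L1.integral_eq' ℂ f, (mem_unitFace.1 hf).2, norm_one] at hle

lemma indicatorConstLp_inv_mem_unitFace_integral {A : Set α} (hA : MeasurableSet A)
    (hμA : μ A ≠ ⊤) (hμA0 : μ A ≠ 0) :
    indicatorConstLp 1 hA hμA ((μ.real A : ℂ)⁻¹) ∈ unitFace (L1.integralCLM' ℂ) := by
  have hreal : μ.real A ≠ 0 := (ENNReal.toReal_pos hμA0 hμA).ne'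
  refine mem_unitFace.2 ⟨?_, ?_⟩
  · rw [norm_indicatorConstLp one_ne_zero ENNReal.one_ne_top]
    simp [abs_of_nonneg, hreal]
  · rw [integralCLM'_apply, integral_indicatorConstLp, Complex.real_smul]
    exact mul_inv_cancel₀ (by exact_mod_cast hreal)

lemma isNormingFace_integral : IsNormingFace (L1.integralCLM' ℂ : StrongDual ℂ (Lp ℂ 1 μ)) := by
  refine fun η C hC hη => opNorm_le_of_norm_indicatorConstLp_le η hC fun A hA hμA z => ?_
  rcases eq_or_ne (μ A) 0 with hμA0 | hμA0
  · have hzero : indicatorConstLp 1 hA hμA z = 0 := by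
      rw [← norm_eq_zero, norm_indicatorConstLp one_ne_zero ENNReal.one_ne_top]
      simp [Measure.real, hμA0]
    simp [hzero]
  · have hdensity := indicatorConstLp_inv_mem_unitFace_integral hA hμA hμA0
    have hreal : (μ.real A : ℂ) ≠ 0 := by
      exact_mod_cast (ENNReal.toReal_pos hμA0 hμA).ne'
    have hz : indicatorConstLp 1 hA hμA z =
        (z * μ.real A) • indicatorConstLp 1 hA hμA ((μ.real A : ℂ)⁻¹) := by
      rw [smul_indicatorConstLp, smul_eq_mul, mul_inv_cancel_right₀ hreal]
    rw [hz, map_smul, norm_smul, norm_smul, mul_left_comm]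
    refine mul_le_mul_of_nonneg_left ((hη _ hdensity).trans ?_) (norm_nonneg _)
    exact le_mul_of_one_le_right hC (one_le_norm_of_mem_unitFace_integral hdensity)

end Densities

section Coordinates

variable {α : Type*} [MeasurableSpace α] {μ : Measure α} {p : ENNReal} [Fact (1 ≤ p)]

lemma sum_compLpL {𝕜 E F κ : Type*} [NontriviallyNormedField 𝕜] [NormedAddCommGroup E]
    [NormedSpace 𝕜 E] [NormedAddCommGroup F] [NormedSpace 𝕜 F] (s : Finset κ)
    (L : κ → E →L[𝕜] F) :
    (∑ i ∈ s, L i).compLpL p μ = ∑ i ∈ s, (L i).compLpL p μ :=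
  map_sum ((ContinuousLinearMap.id 𝕜 (E →L[𝕜] F)).compLpL₂ p μ) L s

variable {ι : Type*} [Fintype ι] [DecidableEq ι]

/-- The inclusion of `Lᵖ(μ)` into the `i`-th coordinate of `Lᵖ(μ; ℂ^ι)`, where `ℂ^ι` carries the
maximum norm. -/
noncomputable def lpSingle (p : ENNReal) [Fact (1 ≤ p)] (μ : Measure α) (i : ι) :
    Lp ℂ p μ →L[ℂ] Lp (ι → ℂ) p μ :=
  (ContinuousLinearMap.single ℂ (fun _ => ℂ) i).compLpL p μ

lemma coeFn_lpSingle (i : ι) (f : Lp ℂ p μ) :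
    lpSingle p μ i f =ᵐ[μ] fun x => Pi.single i (f x) :=
  (ContinuousLinearMap.single ℂ (fun _ => ℂ) i).coeFn_compLpL f

lemma norm_sum_smul_lpSingle_le {c : ι → ℂ} (hc : ∀ i, ‖c i‖ ≤ 1) :
    ‖∑ i, c i • lpSingle p μ i‖ ≤ 1 := by
  set L : ℂ →L[ℂ] (ι → ℂ) := ∑ i, c i • ContinuousLinearMap.single ℂ (fun _ => ℂ) i with hL
  have hsum : ∑ i, c i • lpSingle p μ i = L.compLpL p μ := by
    rw [hL, sum_compLpL]
    exact Finset.sum_congr rfl fun i _ => (ContinuousLinearMap.smul_compLpL _ _).symm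
  rw [hsum]
  refine (ContinuousLinearMap.norm_compLpL_le L).trans (L.opNorm_le_bound zero_le_one fun z => ?_)
  rw [one_mul, pi_norm_le_iff_of_nonneg (norm_nonneg z)]
  intro i
  simpa [L, Finset.sum_apply, Pi.single_apply] using mul_le_of_le_one_left (norm_nonneg z) (hc i)

lemma weakSummingNorm_comp_lpSingle_le {n : ℕ} (φ : StrongDual ℂ (Lp (Fin n → ℂ) p μ)) :
    MultiNorm.weakSummingNorm 1 (fun i => φ.comp (lpSingle p μ i)) ≤ ‖φ‖ := by
  refine MultiNorm.weakSummingNorm_one_le_of_norm_sum_smul_le fun c hc => ?_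
  have hcomp : ∑ i, c i • φ.comp (lpSingle p μ i) = φ.comp (∑ i, c i • lpSingle p μ i) := by
    ext f
    simp [map_sum]
  rw [hcomp]
  exact (φ.opNorm_comp_le _).trans
    (mul_le_of_le_one_right (norm_nonneg φ) (norm_sum_smul_lpSingle_le fun i => (hc i).le))

end Coordinates

section Translates

variable {G : Type*} [Group G] [TopologicalSpace G] [IsTopologicalGroup G]
  [MeasurableSpace G] [BorelSpace G] {m : Measure G} [m.IsMulLeftInvariant]

lemma coeFn_leftTranslate (s : G) (f : Lp ℂ 1 m) :
    leftTranslate m s f =ᵐ[m] fun x => f (s⁻¹ * x) :=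
  Lp.coeFn_compMeasurePreserving f (measurePreserving_mul_left m s⁻¹)

/-- The map `f ↦ (sᵢ · f)ᵢ` from `L¹(G)` to `L¹(G; ℂ^ι)`. -/
noncomputable def translatesMap (m : Measure G) [m.IsMulLeftInvariant] {ι : Type*} [Fintype ι]
    [DecidableEq ι] (s : ι → G) : Lp ℂ 1 m →L[ℂ] Lp (ι → ℂ) 1 m :=
  ∑ i, (lpSingle 1 m i).comp (leftTranslate m (s i))

lemma translatesMap_apply {ι : Type*} [Fintype ι] [DecidableEq ι] (s : ι → G) (f : Lp ℂ 1 m) :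
    translatesMap m s f = ∑ i, lpSingle 1 m i (leftTranslate m (s i) f) := by
  simp [translatesMap]

lemma coeFn_translatesMap {ι : Type*} [Fintype ι] [DecidableEq ι] (s : ι → G) (f : Lp ℂ 1 m) :
    translatesMap m s f =ᵐ[m] fun x i => f ((s i)⁻¹ * x) := by
  rw [translatesMap_apply]
  filter_upwards [Lp.coeFn_fun_finsetSum Finset.univ fun i =>
      lpSingle 1 m i (leftTranslate m (s i) f),
    ae_all_iff.2 fun i => coeFn_lpSingle i (leftTranslate m (s i) f),
    ae_all_iff.2 fun i => coeFn_leftTranslate (s i) f] with x hsum hsingle htranslate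
  simp only [hsum, hsingle, htranslate]
  exact Finset.univ_sum_single fun i => f ((s i)⁻¹ * x)

lemma norm_apply_comp_translatesMap_le {q : ℝ} (hq : 1 ≤ q)
    (Λ : StrongDual ℂ (StrongDual ℂ (Lp ℂ 1 m))) {n : ℕ} (s : Fin n → G)
    (φ : StrongDual ℂ (Lp (Fin n → ℂ) 1 m)) :
    ‖Λ (φ.comp (translatesMap m s))‖ ≤ (n : ℝ) ^ (1 - 1 / q) *
      MultiNorm.weakMultiNorm 1 q (fun i => bidualTranslate m (s i) Λ) * ‖φ‖ := by
  set x : Fin n → StrongDual ℂ (StrongDual ℂ (Lp ℂ 1 m)) := fun i => bidualTranslate m (s i) Λ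
  set φcoord : Fin n → StrongDual ℂ (Lp ℂ 1 m) := fun i => φ.comp (lpSingle 1 m i)
  have hdecomp : Λ (φ.comp (translatesMap m s)) = ∑ i, x i (φcoord i) := by
    have hφ : φ.comp (translatesMap m s) = ∑ i, (φcoord i).comp (leftTranslate m (s i)) := by
      ext f
      simp [translatesMap_apply, φcoord, map_sum]
    rw [hφ, map_sum]
    rfl
  calc ‖Λ (φ.comp (translatesMap m s))‖ ≤ ∑ i, ‖x i (φcoord i)‖ := by
        rw [hdecomp]
        exact norm_sum_le _ _
    _ ≤ (n : ℝ) ^ (1 - 1 / q) *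
          (MultiNorm.weakSummingNorm 1 φcoord * MultiNorm.weakMultiNorm 1 q x) :=
        MultiNorm.sum_norm_dual_apply_le le_rfl hq x φcoord
    _ ≤ (n : ℝ) ^ (1 - 1 / q) * (‖φ‖ * MultiNorm.weakMultiNorm 1 q x) := by
        gcongr
        · exact MultiNorm.weakMultiNorm_nonneg 1 q x
        · exact weakSummingNorm_comp_lpSingle_le φ
    _ = (n : ℝ) ^ (1 - 1 / q) * MultiNorm.weakMultiNorm 1 q x * ‖φ‖ := by ring

lemma IsMean.exists_density_norm_translatesMap_lt {q : ℝ} (hq : 1 ≤ q)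
    {Λ : StrongDual ℂ (StrongDual ℂ (Lp ℂ 1 m))} (hΛ : IsMean m Λ) {n : ℕ} (s : Fin n → G)
    {a : ℝ} (ha : (n : ℝ) ^ (1 - 1 / q) *
      MultiNorm.weakMultiNorm 1 q (fun i => bidualTranslate m (s i) Λ) < a) :
    ∃ f ∈ unitFace (L1.integralCLM' ℂ : StrongDual ℂ (Lp ℂ 1 m)), ‖translatesMap m s f‖ < a :=
  isNormingFace_integral.exists_norm_apply_lt hΛ.2.le hΛ.1 _
    (mul_nonneg (by positivity) (MultiNorm.weakMultiNorm_nonneg 1 q _)) ha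
    (norm_apply_comp_translatesMap_le hq Λ s)

end Translates

section LevelSets

lemma exists_measure_lt_norm_lt_of_lintegral_enorm_lt {α E F : Type*} [MeasurableSpace α]
    {μ : Measure α} [NormedAddCommGroup E] [NormedAddCommGroup F] {f : α → E} {g : α → F}
    (hf : AEStronglyMeasurable f μ) (hg : AEStronglyMeasurable g μ) {c : ENNReal} (hc : c ≠ ⊤)
    (h : ∫⁻ x, ‖g x‖ₑ ∂μ < c * ∫⁻ x, ‖f x‖ₑ ∂μ) :
    ∃ t : ℝ, 0 < t ∧ μ {x | t < ‖g x‖} < c * μ {x | t < ‖f x‖} := by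
  by_contra! hcon
  simp only [← ofReal_norm] at h
  rw [lintegral_eq_lintegral_meas_lt μ (.of_forall fun _ => norm_nonneg _) hf.norm.aemeasurable,
    lintegral_eq_lintegral_meas_lt μ (.of_forall fun _ => norm_nonneg _) hg.norm.aemeasurable,
    ← lintegral_const_mul' _ _ hc] at h
  exact h.not_ge (setLIntegral_mono' measurableSet_Ioi hcon)

lemma setOf_lt_norm_translates {G E ι : Type*} [Group G] [SeminormedAddGroup E] [Fintype ι]
    (s : ι → G) (f : G → E) {t : ℝ} (ht : 0 ≤ t) :
    {x | t < ‖fun i => f ((s i)⁻¹ * x)‖} = Set.range s * {x | t < ‖f x‖} := by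
  ext x
  rw [Set.mem_ofPred_eq, ← not_le, pi_norm_le_iff_of_nonneg ht]
  push Not
  constructor
  · rintro ⟨i, hi⟩
    exact ⟨s i, ⟨i, rfl⟩, (s i)⁻¹ * x, hi, mul_inv_cancel_left _ _⟩
  · rintro ⟨_, ⟨i, rfl⟩, y, hy, rfl⟩
    exact ⟨i, by simpa using hy⟩

variable {G : Type*} [Group G] [TopologicalSpace G] [MeasurableSpace G] {m : Measure G}

lemma exists_measure_range_mul_lt [IsTopologicalGroup G] [BorelSpace G] [m.IsMulLeftInvariant]
    {ι : Type*} [Fintype ι] [DecidableEq ι] (s : ι → G) {f : Lp ℂ 1 m} {a : ℝ}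
    (h : ‖translatesMap m s f‖ < a * ‖f‖) :
    ∃ t : ℝ, 0 < t ∧
      m (Set.range s * {x | t < ‖f x‖}) < ENNReal.ofReal a * m {x | t < ‖f x‖} := by
  have hlint : ∫⁻ x, ‖translatesMap m s f x‖ₑ ∂m < ENNReal.ofReal a * ∫⁻ x, ‖f x‖ₑ ∂m := by
    rw [← eLpNorm_one_eq_lintegral_enorm, ← eLpNorm_one_eq_lintegral_enorm, ← Lp.enorm_def,
      ← Lp.enorm_def, ← ofReal_norm, ← ofReal_norm, ← ENNReal.ofReal_mul' (norm_nonneg f)]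
    exact (ENNReal.ofReal_lt_ofReal_iff_of_nonneg (norm_nonneg _)).2 h
  obtain ⟨t, ht, hlt⟩ := exists_measure_lt_norm_lt_of_lintegral_enorm_lt
    (Lp.aestronglyMeasurable f) (Lp.aestronglyMeasurable _) ENNReal.ofReal_ne_top hlint
  refine ⟨t, ht, ?_⟩
  rw [← setOf_lt_norm_translates s f ht.le]
  refine (measure_congr ?_).trans_lt hlt
  filter_upwards [coeFn_translatesMap s f] with x hx
  exact congrArg (fun y => t < ‖y‖) hx.symm

lemma exists_isCompact_measureReal_mul_le [IsFiniteMeasureOnCompacts m]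
    [m.InnerRegularCompactLTTop] (F : Set G) {A : Set G} (hA : MeasurableSet A) (hmA : m A ≠ ⊤)
    {a : ℝ} (h : m (F * A) < ENNReal.ofReal a * m A) :
    ∃ S : Set G, IsCompact S ∧ m S ≠ 0 ∧ m.real (F * S) / m.real S ≤ a := by
  obtain ⟨S, hSA, hS, hlt⟩ :=
    hA.exists_lt_isCompact_of_ne_top hmA (ENNReal.div_lt_of_lt_mul' h)
  have hS0 : m S ≠ 0 := (zero_le.trans_lt hlt).ne'
  have hStop : m S ≠ ⊤ := hS.measure_lt_top.ne
  have ha : 0 < a := ENNReal.ofReal_pos.1 (pos_of_mul_pos_left (zero_le.trans_lt h) zero_le)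
  have hle : m (F * S) ≤ ENNReal.ofReal a * m S :=
    calc m (F * S) ≤ m (F * A) := measure_mono (Set.mul_subset_mul_left hSA)
      _ ≤ m S * ENNReal.ofReal a :=
        (ENNReal.div_le_iff (ENNReal.ofReal_pos.2 ha).ne' ENNReal.ofReal_ne_top).1 hlt.le
      _ = ENNReal.ofReal a * m S := mul_comm _ _
  refine ⟨S, hS, hS0, (div_le_iff₀ (ENNReal.toReal_pos hS0 hStop)).2 ?_⟩
  have hreal := ENNReal.toReal_mono (ENNReal.mul_ne_top ENNReal.ofReal_ne_top hStop) hle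
  rwa [ENNReal.toReal_mul, ENNReal.toReal_ofReal ha.le] at hreal

end LevelSets

section Folner

variable {G : Type*} [Group G] [TopologicalSpace G] [IsTopologicalGroup G] [MeasurableSpace G]
  [BorelSpace G] {m : Measure G} [m.IsMulLeftInvariant] [IsFiniteMeasureOnCompacts m]
  [m.InnerRegularCompactLTTop] {q : ℝ}

lemma IsMean.exists_isCompact_measureReal_range_mul_le (hq : 1 ≤ q)
    {Λ : StrongDual ℂ (StrongDual ℂ (Lp ℂ 1 m))} (hΛ : IsMean m Λ) {n : ℕ} (s : Fin n → G)
    {a : ℝ} (ha : (n : ℝ) ^ (1 - 1 / q) *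
      MultiNorm.weakMultiNorm 1 q (fun i => bidualTranslate m (s i) Λ) < a) :
    ∃ S : Set G, IsCompact S ∧ m S ≠ 0 ∧ m.real (Set.range s * S) / m.real S ≤ a := by
  obtain ⟨f, hf, hfs⟩ := hΛ.exists_density_norm_translatesMap_lt hq s ha
  have ha0 : 0 ≤ a := (norm_nonneg _).trans hfs.le
  have hlt : ‖translatesMap m s f‖ < a * ‖f‖ :=
    hfs.trans_le (le_mul_of_one_le_right ha0 (one_le_norm_of_mem_unitFace_integral hf))
  obtain ⟨t, ht, hlevel⟩ := exists_measure_range_mul_lt s hlt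
  exact exists_isCompact_measureReal_mul_le _
    (measurableSet_lt measurable_const (Lp.stronglyMeasurable f).norm.measurable)
    ((L1.integrable_coeFn f).measure_norm_gt_lt_top ht).ne hlevel

lemma IsPQAmenable.exists_isCompact_measureReal_mul_le (hq : 1 ≤ q) (hG : IsPQAmenable m 1 q) :
    ∃ C : ℝ, 1 ≤ C ∧ ∀ F : Finset G, ∃ S : Set G, IsCompact S ∧ m S ≠ 0 ∧
      m.real ((F : Set G) * S) / m.real S ≤ C * (F.card : ℝ) ^ (1 - 1 / q) := by
  obtain ⟨Λ, hΛ, B, hB⟩ := hG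
  have hnonempty : ∀ F : Finset G, F.Nonempty → ∃ S : Set G, IsCompact S ∧ m S ≠ 0 ∧
      m.real ((F : Set G) * S) / m.real S ≤
        (max B 0 + 1) * (F.card : ℝ) ^ (1 - 1 / q) := fun F hF => by
    set s : Fin F.card → G := fun i => F.equivFin.symm i
    have hrange : Set.range s = F := by
      rw [Set.range_comp' Subtype.val, F.equivFin.symm.range_eq_univ, Set.image_univ,
        Subtype.range_coe_subtype]
      rfl
    have hmulti : MultiNorm.weakMultiNorm 1 q (fun i => bidualTranslate m (s i) Λ) <
        max B 0 + 1 :=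
      calc _ ≤ B := hB ⟨_, _, fun i => Set.mem_range_self (s i), rfl⟩
        _ ≤ max B 0 := le_max_left B 0
        _ < max B 0 + 1 := lt_add_one _
    have hcard : 0 < (F.card : ℝ) := by exact_mod_cast hF.card_pos
    rw [← hrange]
    refine hΛ.exists_isCompact_measureReal_range_mul_le hq s ?_
    rw [mul_comm]
    exact mul_lt_mul_of_pos_right hmulti (Real.rpow_pos_of_pos hcard _)
  refine ⟨max B 0 + 1, by simp, fun F => ?_⟩
  rcases F.eq_empty_or_nonempty with rfl | hF
  · obtain ⟨S, hS, hmS, -⟩ := hnonempty {1} (Finset.singleton_nonempty 1)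
    refine ⟨S, hS, hmS, ?_⟩
    rw [Finset.coe_empty, Set.empty_mul, measureReal_empty, zero_div]
    positivity
  · exact hnonempty F hF

end Folner

theorem mainTheorem4_general {G : Type*} [Group G] [TopologicalSpace G] [IsTopologicalGroup G]
    [MeasurableSpace G] [BorelSpace G] (m : Measure G) [m.IsMulLeftInvariant]
    [IsFiniteMeasureOnCompacts m] [m.InnerRegularCompactLTTop] (q : ℝ) (hq : 1 ≤ q)
    (hG : IsPQAmenable m 1 q) :
    (∃ C : ℝ, 1 ≤ C ∧ ∀ (n : ℕ) (F : Finset G), F.card = n →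
      ∃ S : Set G, IsCompact S ∧ m S ≠ 0 ∧
        m.real ((F : Set G) * S) / m.real S ≤ C * (n : ℝ) ^ (1 - 1 / q)) ∧
    (∀ ε : ℝ, 0 < ε → ∃ n₀ : ℕ, ∀ n : ℕ, n₀ ≤ n → ∀ F : Finset G, F.card = n →
      ∃ S : Set G, IsCompact S ∧ m S ≠ 0 ∧
        m.real ((F : Set G) * S) / m.real S ≤ ε * (n : ℝ)) := by
  obtain ⟨C, hC1, hC⟩ := hG.exists_isCompact_measureReal_mul_le hq
  refine ⟨⟨C, hC1, fun n F hF => hF ▸ hC F⟩, fun ε hε => ?_⟩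
  have hexp : 1 - 1 / q < 1 := sub_lt_self 1 (by positivity)
  have hsublinear : ∀ᶠ x : ℝ in Filter.atTop, C * x ^ (1 - 1 / q) ≤ ε * x := by
    filter_upwards [((isLittleO_rpow_rpow_atTop_of_lt hexp).const_mul_left C).def hε,
      Filter.eventually_ge_atTop 0] with x hle hx
    rw [Real.rpow_one, Real.norm_of_nonneg hx] at hle
    exact (le_abs_self _).trans hle
  obtain ⟨n₀, hn₀⟩ := Filter.eventually_atTop.1
    (tendsto_natCast_atTop_atTop.eventually hsublinear)
  refine ⟨n₀, fun n hn F hF => ?_⟩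
  obtain ⟨S, hS, hmS, hle⟩ := hC F
  exact ⟨S, hS, hmS, hle.trans (hF ▸ hn₀ _ (hF ▸ hn))⟩

theorem mainTheorem4 {G : Type*} [Group G] [TopologicalSpace G] [IsTopologicalGroup G]
    [LocallyCompactSpace G] [T2Space G] [MeasurableSpace G] [BorelSpace G]
    (m : Measure G) [m.IsHaarMeasure] [m.Regular] (q : ℝ) (hq : 1 < q)
    (hG : IsPQAmenable m 1 q) :
    (∃ C : ℝ, 1 ≤ C ∧ ∀ (n : ℕ) (F : Finset G), F.card = n →
      ∃ S : Set G, IsCompact S ∧ m S ≠ 0 ∧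
        m.real ((F : Set G) * S) / m.real S ≤ C * (n : ℝ) ^ (1 - 1 / q)) ∧
    (∀ ε : ℝ, 0 < ε → ∃ n₀ : ℕ, ∀ n : ℕ, n₀ ≤ n → ∀ F : Finset G, F.card = n →
      ∃ S : Set G, IsCompact S ∧ m S ≠ 0 ∧
        m.real ((F : Set G) * S) / m.real S ≤ ε * (n : ℝ)) :=
  mainTheorem4_general m q hq.le hG
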